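/- **Network.** Let $M\in\mathbb N$. There are $M$ pairs of terminals $(A_1,B_1),\dots,(A_M,B_M)$ and a relay $R$. Terminal $A_i$ has a message for $B_i$ and $B_i$ has a message for $A_i$; there are no direct links between terminals. For each terminal $u$ let $n_{uR}$ and $n_{Ru}$ be non-negative integers (uplink and downlink channel gains), let $q$ be the largest of all these gains and let $\mathbf S$ be the $q\times q$ down-shift matrix over $\mathbb F_2$. In each time slot the nodes transmit vectors in $\mathbb F_2^q$ (most significant level first), and the linear shift deterministic channel delivers $\mathbf y_R=\sum_u \mathbf S^{\,q-n_{uR}}\mathbf x_u$ to the relay and $\mathbf y_u=\mathbf S^{\,q-n_{Ru}}\mathbf x_R$ to each terminal $u$. The relay is half-duplex with a non-adaptive schedule: for a given $\Delta\in[0,1]$, in a block of $N$ slots it listens in a set of slots fixed in advance, whose size is $\Delta N$ up to rounding to a neighbouring integer ($\mathbf x_R=0$ in these slots), and it transmits in the remaining slots ($\mathbf y_R=0$ in these slots). **Capacity region.** In a block code of length $N$, what a node transmits in a slot is a function of what it has received before and, for a terminal, of its own message; at the end each terminal estimates its partner's message from its own message and everything it has received. Messages are independent and uniform. A rate tuple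 $(R_u)_u$ with $R_u\ge 0$ is achievable if for all large $N$ there are such codes with at least $2^{NR_u}$ messages at each terminal $u$ and with probability that some estimate is wrong tending to $0$. The capacity region is the closure of the set of achievable rate tuples. **Divide-and-conquer relaying.** A code is a divide-and-conquer relaying strategy if (i) every message is a string of uncoded bits, each of which is sent once, in a slot in which the relay listens and on a level that the relay receives, all other levels being zero; (ii) no signal level (in any slot) at the relay is used by more than one pair, so that at each level the relay receives nothing, one bit of one terminal, or the XOR of one bit of $A_i$ and one bit of $B_i$ for a single $i$; (iii) the relay only reorders the received levels by a permutation $\Pi$ of the signal levels of the block and forwards them ($\mathbf x_R=\Pi\mathbf y_R$), each level that carries a bit meant for $u$ being forwarded later, in a slot in which the relay transmits, on a level that $u$ receives; (iv) each terminal reads off the levels that carry its partner's bits and removes its own bit where one was superposed. **Statement.** For all $M$, all channel gains and all $\Delta\in[0,1]$, the capacity region of the network with half-duplex relay that listens a fraction $\Delta$ of the time equals the half-duplex cut-set bound, i.e. the set of all non-negative rate tuples $(R_{A_1},R_{B_1},\dots,R_{A_M},R_{B_M})$ such that $$\sum_{i\in\mathcal U}\bigl[\ell_iR_{A_i}+(1-\ell_i)R_{B_i}\bigr]\le\min\Bigl(\Delta\max_{i\in\mathcal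 U}\bigl(\ell_in_{A_iR}+(1-\ell_i)n_{B_iR}\bigr),\;(1-\Delta)\max_{i\in\mathcal U}\bigl(\ell_in_{RB_i}+(1-\ell_i)n_{RA_i}\bigr)\Bigr)$$ for all $\mathcal U\subseteq\{1,\dots,M\}$ and all $\ell_1,\dots,\ell_M\in\{0,1\}$ (the maximum over the empty set being $0$). Moreover it is achieved by divide-and-conquer relaying: the closure of the set of rate tuples that are achievable with divide-and-conquer relaying strategies is the same set. -/

import Mathlib

open Filter

namespace BidirRelay

noncomputable section

/-! ### The linear shift deterministic channel -/

/-- The `q × q` shift matrix over `𝔽₂`, which moves every entry of a vector one place down.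
Index `0` is the most significant level. -/
def shiftMatrix (q : ℕ) : Matrix (Fin q) (Fin q) (ZMod 2) :=
  Matrix.of fun i j => if (i : ℕ) = (j : ℕ) + 1 then 1 else 0

/-- The number of signal levels: the largest channel gain of the network. -/
def maxGain {V : Type} [Fintype V] (n : V → V → ℕ) : ℕ :=
  Finset.univ.sup fun i => Finset.univ.sup fun j => n i j

/-- The signal received by node `j` when node `k` transmits `x k`, where `n k j` is the gain of
the channel from `k` to `j`. -/
def channelOutput {V : Type} [Fintype V] (n : V → V → ℕ)
    (x : V → Fin (maxGain n) → ZMod 2) (j : V) : Fin (maxGain n) → ZMod 2 :=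
  ∑ k, (shiftMatrix (maxGain n) ^ (maxGain n - n k j)).mulVec (x k)

/-! ### The network of `M` pairs and a relay -/

/-- The terminals: `Sum.inl i` is `A_i` and `Sum.inr i` is `B_i`. The terminal that `u` is paired
with is `u.swap`. -/
abbrev Terminal (M : ℕ) : Type := Fin M ⊕ Fin M

/-- The terminal `A_i`. -/
abbrev nodeA {M : ℕ} (i : Fin M) : Terminal M := Sum.inl i

/-- The terminal `B_i`. -/
abbrev nodeB {M : ℕ} (i : Fin M) : Terminal M := Sum.inr i

/-- The index of the pair that a terminal belongs to. -/
def pairOf {M : ℕ} (u : Terminal M) : Fin M := Sum.elim id id u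

/-- The nodes of the network: the terminals and the relay `none`. -/
abbrev Node (M : ℕ) : Type := Option (Terminal M)

/-- The channel gains: `up u` from the terminal `u` to the relay, `down u` from the relay
to the terminal `u`. -/
structure Gains (M : ℕ) where
  up : Terminal M → ℕ
  down : Terminal M → ℕ

/-- The gains as a function of transmitting and receiving node; there is no direct channel between
two terminals. -/
def Gains.gain {M : ℕ} (G : Gains M) : Node M → Node M → ℕ
  | some u, none => G.up u
  | none, some u => G.down u
  | _, _ => 0

/-- The number `q` of signal levels of the network. -/
def Gains.q {M : ℕ} (G : Gains M) : ℕ := maxGain G.gain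

/-- Signals, vectors in `𝔽₂^q`. -/
abbrev Gains.Signal {M : ℕ} (G : Gains M) : Type := Fin G.q → ZMod 2

/-! ### Codes for the half-duplex relay -/

/-- A block code of length `N` for the half-duplex network. The set `listen` of time slots in which
the relay listens is fixed in advance; in the other slots it transmits. Terminal `u` has a message
in `Fin (size u)`. The signal that a node transmits at time `t` may depend on everything it
received before time `t` and, for a terminal, on its message. At the end each terminal
estimates the message of its partner from its own message and all it received. -/
structure HalfDuplexCode {M : ℕ} (G : Gains M) (N : ℕ) where
  listen : Finset ℕ
  listen_subset : listen ⊆ Finset.range N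
  size : Terminal M → ℕ
  size_pos : ∀ u, 0 < size u
  enc : (u : Terminal M) → Fin (size u) → (t : ℕ) → (Fin t → G.Signal) → G.Signal
  relayEnc : (t : ℕ) → (Fin t → G.Signal) → G.Signal
  dec : (u : Terminal M) → Fin (size u) → (Fin N → G.Signal) → Fin (size u.swap)

namespace HalfDuplexCode

variable {M : ℕ} {G : Gains M} {N : ℕ}

/-- A choice of a message for every terminal. -/
abbrev Messages (C : HalfDuplexCode G N) : Type := (u : Terminal M) → Fin (C.size u)

/-- The signals transmitted at time `t` if node `v` has received `h v` before. While the relay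
listens it transmits nothing. -/
def transmitted (C : HalfDuplexCode G N) (w : C.Messages) (t : ℕ)
    (h : Node M → Fin t → G.Signal) : Node M → G.Signal
  | some u => C.enc u (w u) t (h (some u))
  | none => if t ∈ C.listen then 0 else C.relayEnc t (h none)

/-- The signals received at time `t` if node `v` has received `h v` before. While the relay
transmits it receives nothing. -/
def received (C : HalfDuplexCode G N) (w : C.Messages) (t : ℕ)
    (h : Node M → Fin t → G.Signal) : Node M → G.Signal
  | some u => channelOutput G.gain (C.transmitted w t h) (some u)
  | none => if t ∈ C.listen then channelOutput G.gain (C.transmitted w t h) none else 0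

/-- The signals that each node receives in the time slots `0, …, t - 1` when the messages
are `w`. -/
def history (C : HalfDuplexCode G N) (w : C.Messages) :
    (t : ℕ) → Node M → Fin t → G.Signal
  | 0 => fun _ => Fin.elim0
  | t + 1 => fun v => Fin.snoc (α := fun _ => G.Signal) (history C w t v)
      (received C w t (history C w t) v)

/-- The probability that some terminal estimates its partner's message wrongly, when the messages
are independent and uniformly distributed. -/
def errorProb (C : HalfDuplexCode G N) : ℝ :=
  ((Finset.univ.filter fun w : C.Messages =>
      ∃ u, C.dec u (w u) (C.history w N (some u)) ≠ w u.swap).card : ℝ) /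
    (Fintype.card C.Messages : ℝ)

/-- The relay listens a fraction `Δ` of the time, up to rounding `Δ N` to one of the two integers
next to it (if `Δ N` is an integer then the number of listening slots is equal to it). -/
def ListensFraction (C : HalfDuplexCode G N) (Δ : ℝ) : Prop :=
  |(C.listen.card : ℝ) - Δ * N| < 1

/-- `C` together with this data is a divide-and-conquer relaying strategy. -/
structure DivideAndConquer (C : HalfDuplexCode G N) where
  /-- The message of `u` consists of `k u` uncoded bits. -/
  k : Terminal M → ℕ
  bits : (u : Terminal M) → Fin (C.size u) ≃ (Fin (k u) → ZMod 2)
  /-- The time slot and the signal level at which each bit of `u` arrives at the relay: a slot in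
  which the relay listens, a level that is connected to `u`, and different positions for
  different bits of `u`. -/
  rx : (u : Terminal M) → Fin (k u) ↪ Fin N × Fin G.q
  rx_listen : ∀ u b, ((rx u b).1 : ℕ) ∈ C.listen
  rx_level : ∀ u b, G.q - G.up u ≤ ((rx u b).2 : ℕ)
  /-- Orthogonalization: no signal level at the relay is used by two different pairs. -/
  orthogonal : ∀ u v b c, rx u b = rx v c → pairOf u = pairOf v
  /-- Each terminal transmits each of its bits once, on the level from which it arrives
  at the relay in the position given by `rx`, and zeros on all other levels. -/
  enc_eq : ∀ (u : Terminal M) (w : Fin (C.size u)) (t : Fin N) (h : Fin t → G.Signal)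
    (l : Fin G.q), C.enc u w t h l =
      ∑ b, if (rx u b).1 = t ∧ ((rx u b).2 : ℕ) = (l : ℕ) + (G.q - G.up u)
        then bits u w b else 0
  /-- Reordering and forwarding: over the block the relay transmits `x_R = Π y_R` for a permutation
  of the signal levels; a level on which a bit not yet received would be due is left empty. -/
  perm : Equiv.Perm (Fin N × Fin G.q)
  relay_eq : ∀ (t : Fin N) (h : Fin t → G.Signal) (l : Fin G.q), C.relayEnc t h l =
    if hs : (perm.symm (t, l)).1 < t then h ⟨(perm.symm (t, l)).1, hs⟩ (perm.symm (t, l)).2 else 0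
  /-- The relay level that carries a bit meant for `u` is forwarded later, in a slot in which the
  relay transmits, on a level that is connected to `u`. -/
  forward_later : ∀ (u : Terminal M) (c : Fin (k u.swap)), (rx u.swap c).1 < (perm (rx u.swap c)).1
  forward_transmit : ∀ (u : Terminal M) (c : Fin (k u.swap)), ((perm (rx u.swap c)).1 : ℕ) ∉ C.listen
  forward_level : ∀ (u : Terminal M) (c : Fin (k u.swap)), ((perm (rx u.swap c)).2 : ℕ) < G.down u
  /-- Decoding: `u` reads each bit meant for it off the level at which it arrives, and removes its
  own bit if it has one that was superposed on that bit at the relay. -/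
  dec_eq : ∀ (u : Terminal M) (w : Fin (C.size u)) (y : Fin N → G.Signal) (c : Fin (k u.swap))
    (l : Fin G.q), (l : ℕ) = ((perm (rx u.swap c)).2 : ℕ) + (G.q - G.down u) →
      bits u.swap (C.dec u w y) c =
        y (perm (rx u.swap c)).1 l + ∑ b, if rx u b = rx u.swap c then bits u w b else 0

/-- `C` is a divide-and-conquer relaying strategy. -/
def IsDivideAndConquer (C : HalfDuplexCode G N) : Prop := Nonempty C.DivideAndConquer

end HalfDuplexCode

/-! ### Rate regions -/

/-- The rate tuple `R` (`R u` is the rate, in bits per time slot, at which `u` sends to its partner)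
is achievable with codes in the class `P` by a relay that listens a fraction `Δ` of the time: for
all large block lengths `N` there are codes with at least `2 ^ (N * R u)` messages of each terminal
`u`, with error probability tending to zero. -/
def Achievable {M : ℕ} (G : Gains M) (Δ : ℝ) (P : ∀ N : ℕ, HalfDuplexCode G N → Prop)
    (R : Terminal M → ℝ) : Prop :=
  (∀ u, 0 ≤ R u) ∧
  ∀ ε : ℝ, 0 < ε → ∀ᶠ N : ℕ in atTop, ∃ C : HalfDuplexCode G N,
    P N C ∧ C.ListensFraction Δ ∧ C.errorProb ≤ ε ∧
      ∀ u, (2 : ℝ) ^ ((N : ℝ) * R u) ≤ (C.size u : ℝ)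

/-- The capacity region: the closure of the set of achievable rate tuples. -/
def capacityRegion {M : ℕ} (G : Gains M) (Δ : ℝ) : Set (Terminal M → ℝ) :=
  closure {R | Achievable G Δ (fun _ _ => True) R}

/-- The closure of the set of rate tuples that are achievable with divide-and-conquer relaying
strategies. -/
def divideAndConquerRegion {M : ℕ} (G : Gains M) (Δ : ℝ) : Set (Terminal M → ℝ) :=
  closure {R | Achievable G Δ (fun _ C => C.IsDivideAndConquer) R}

/-- The half-duplex cut-set bound; `ℓ i = true` stands for `ℓ_i = 1`. -/
def cutSetRegion {M : ℕ} (G : Gains M) (Δ : ℝ) : Set (Terminal M → ℝ) :=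
  {R | (∀ u, 0 ≤ R u) ∧ ∀ (U : Finset (Fin M)) (ℓ : Fin M → Bool),
    (∑ i ∈ U, if ℓ i then R (nodeA i) else R (nodeB i)) ≤
      min (Δ * ((U.sup fun i => if ℓ i then G.up (nodeA i) else G.up (nodeB i) : ℕ) : ℝ))
        ((1 - Δ) * ((U.sup fun i => if ℓ i then G.down (nodeB i) else G.down (nodeA i) : ℕ) : ℝ))}

end

end BidirRelay

namespace BidirRelay

/-! ### The channel -/

/-! Converse: take one sender from each pair in `U` and fix all other messages. If the levels these
senders can reach at the relay agree in the listening slots, then by induction on time all histories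
agree, so correctly decoded messages agree (`prod_size_le_uplink`). The relay levels visible to the
partners in the transmitting slots serve equally well (`prod_size_le_downlink`). At least half of
all message tuples are decoded correctly once the error is at most 1/2, so counting costs only a
factor 2, which vanishes in the rate.

Achievability: superpose equally indexed bits of `A_i` and `B_i` into a packet, limited by the
weaker gain of the terminals involved. The sets of positions open to packets are nested, so Hall's
condition only asks that few packets have gain at most `g`; this is a cut-set inequality for a
suitable `U` and `ℓ` (`card_packetGain_le`, `exists_positions`). Uplink and downlink positions are
allocated separately and joined by a permutation (`exists_divideAndConquer`). Scaling the rates by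
`1 - δ` absorbs all rounding, and `δ → 0` reaches the closure. -/

theorem shiftMatrix_mulVec (q : ℕ) (x : Fin q → ZMod 2) (l : Fin q) :
    (shiftMatrix q).mulVec x l = if h : 1 ≤ (l : ℕ) then x ⟨l - 1, by omega⟩ else 0 := by
  simp only [shiftMatrix, Matrix.mulVec, dotProduct, Matrix.of_apply, ite_mul, one_mul, zero_mul]
  split_ifs with h
  · rw [Finset.sum_eq_single ⟨l - 1, by omega⟩]
    · rw [if_pos]; simp only; omega
    · intro j _ hj
      rw [if_neg]
      intro h'
      exact hj (Fin.ext (by simp only; omega))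
    · simp
  · exact Finset.sum_eq_zero fun j _ => if_neg (by omega)

theorem shiftMatrix_pow_mulVec (q s : ℕ) (x : Fin q → ZMod 2) (l : Fin q) :
    (shiftMatrix q ^ s).mulVec x l = if h : s ≤ (l : ℕ) then x ⟨l - s, by omega⟩ else 0 := by
  induction s generalizing l with
  | zero => simp
  | succ s ih =>
    rw [pow_succ', ← Matrix.mulVec_mulVec, shiftMatrix_mulVec]
    by_cases h : s + 1 ≤ (l : ℕ)
    · rw [dif_pos (by omega), ih, dif_pos (by simp only; omega), dif_pos h]
      congr 2
      simp only
      omega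
    · rw [dif_neg h]
      split_ifs with h1
      · rw [ih, dif_neg (by simp only; omega)]
      · rfl

/-- A gain of zero enters the channel as this power; it removes the absent links. -/
theorem shiftMatrix_pow_self_mulVec (q : ℕ) (x : Fin q → ZMod 2) :
    (shiftMatrix q ^ q).mulVec x = 0 := by
  ext l
  rw [shiftMatrix_pow_mulVec, dif_neg (by omega)]
  rfl

theorem le_maxGain {V : Type} [Fintype V] (n : V → V → ℕ) (i j : V) : n i j ≤ maxGain n :=
  (Finset.le_sup (f := fun j => n i j) (Finset.mem_univ j)).trans
    (Finset.le_sup (f := fun i => Finset.univ.sup fun j => n i j) (Finset.mem_univ i))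

variable {M : ℕ} {G : Gains M}

theorem Gains.up_le_q (G : Gains M) (u : Terminal M) : G.up u ≤ G.q :=
  le_maxGain G.gain (some u) none

theorem Gains.down_le_q (G : Gains M) (u : Terminal M) : G.down u ≤ G.q :=
  le_maxGain G.gain none (some u)

theorem channelOutput_relay (x : Node M → G.Signal) (l : Fin G.q) :
    channelOutput G.gain x none l =
      ∑ u, if h : G.q - G.up u ≤ (l : ℕ) then x (some u) ⟨l - (G.q - G.up u), by omega⟩ else 0 := by
  have h0 : (shiftMatrix (maxGain G.gain) ^ (maxGain G.gain - G.gain none none)).mulVec (x none)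
      = 0 := shiftMatrix_pow_self_mulVec _ _
  have h1 := Fintype.sum_option fun k =>
    (shiftMatrix (maxGain G.gain) ^ (maxGain G.gain - G.gain k none)).mulVec (x k)
  rw [h0, zero_add] at h1
  refine (congrFun h1 l).trans ((Finset.sum_apply _ _ _).trans ?_)
  exact Finset.sum_congr rfl fun u _ => shiftMatrix_pow_mulVec _ _ _ _

theorem channelOutput_terminal (x : Node M → G.Signal) (u : Terminal M) (l : Fin G.q) :
    channelOutput G.gain x (some u) l =
      if h : G.q - G.down u ≤ (l : ℕ) then x none ⟨l - (G.q - G.down u), by omega⟩ else 0 := by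
  have h0 : ∀ v : Terminal M, (shiftMatrix (maxGain G.gain) ^
      (maxGain G.gain - G.gain (some v) (some u))).mulVec (x (some v)) = 0 :=
    fun v => shiftMatrix_pow_self_mulVec _ _
  have h1 := Fintype.sum_option fun k =>
    (shiftMatrix (maxGain G.gain) ^ (maxGain G.gain - G.gain k (some u))).mulVec (x k)
  rw [Finset.sum_congr rfl fun v _ => h0 v, Finset.sum_const_zero, add_zero] at h1
  exact (congrFun h1 l).trans (shiftMatrix_pow_mulVec _ _ _ _)

namespace HalfDuplexCode

variable {N : ℕ}

/-! ### Runs of a code -/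

theorem history_apply (C : HalfDuplexCode G N) (w : C.Messages) (T : ℕ) (v : Node M) (s : Fin T) :
    C.history w T v s = C.received w s (C.history w s) v := by
  induction T with
  | zero => exact s.elim0
  | succ T ih =>
    rw [history]
    refine Fin.lastCases ?_ (fun s => ?_) s
    · simp
    · simp [ih]

theorem received_relay_of_mem (C : HalfDuplexCode G N) (w : C.Messages) (t : ℕ)
    (h : Node M → Fin t → G.Signal) (ht : t ∈ C.listen) (l : Fin G.q) :
    C.received w t h none l = ∑ u, if _ : G.q - G.up u ≤ (l : ℕ) then
      C.enc u (w u) t (h (some u)) ⟨l - (G.q - G.up u), by omega⟩ else 0 :=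
  (congrFun (if_pos ht : C.received w t h none =
    (channelOutput G.gain (C.transmitted w t h) none : G.Signal)) l).trans
    (channelOutput_relay _ _)

theorem received_relay_of_notMem (C : HalfDuplexCode G N) (w : C.Messages) (t : ℕ)
    (h : Node M → Fin t → G.Signal) (ht : t ∉ C.listen) : C.received w t h none = 0 :=
  if_neg ht

theorem received_terminal (C : HalfDuplexCode G N) (w : C.Messages) (t : ℕ)
    (h : Node M → Fin t → G.Signal) (u : Terminal M) (l : Fin G.q) :
    C.received w t h (some u) l = if _ : G.q - G.down u ≤ (l : ℕ) then
      C.transmitted w t h none ⟨l - (G.q - G.down u), by omega⟩ else 0 :=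
  channelOutput_terminal _ _ _

/-- All terminals decode correctly when the messages are `w`. -/
def Correct (C : HalfDuplexCode G N) (w : C.Messages) : Prop :=
  ∀ u, C.dec u (w u) (C.history w N (some u)) = w u.swap

/-! ### Divide-and-conquer strategies make no errors -/

namespace DivideAndConquer

variable {C : HalfDuplexCode G N} (D : C.DivideAndConquer)
include D

theorem relay_received (w : C.Messages) (t : Fin N) (ht : (t : ℕ) ∈ C.listen) (l : Fin G.q) :
    C.received w t (C.history w t) none l =
      ∑ u, ∑ b, if D.rx u b = (t, l) then D.bits u (w u) b else 0 := by
  rw [C.received_relay_of_mem w t _ ht]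
  refine Finset.sum_congr rfl fun u _ => ?_
  split_ifs with h
  · rw [D.enc_eq]
    refine Finset.sum_congr rfl fun b _ => ?_
    congr 1
    rw [Prod.ext_iff, Fin.ext_iff (a := (D.rx u b).2)]
    simp only [Nat.sub_add_cancel h]
  -- The signal of `u` does not reach level `l`, and `rx_level` places no bit of `u` there.
  · refine (Finset.sum_eq_zero fun b _ => if_neg fun hb => h ?_).symm
    have := D.rx_level u b
    rwa [hb] at this

/-- Orthogonality leaves only the two terminals of the pair, and injectivity of `rx` leaves only `c`
among the bits of the partner. -/
theorem sum_bits_rx (w : C.Messages) (u : Terminal M) (c : Fin (D.k u.swap)) :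
    (∑ v, ∑ b, if D.rx v b = D.rx u.swap c then D.bits v (w v) b else 0) =
      D.bits u.swap (w u.swap) c +
        ∑ b, if D.rx u b = D.rx u.swap c then D.bits u (w u) b else 0 := by
  have hne : u.swap ≠ u := by cases u <;> simp
  rw [Fintype.sum_eq_add u.swap u hne]
  · congr 1
    simp [(D.rx u.swap).injective.eq_iff]
  · rintro v ⟨h1, h2⟩
    refine Finset.sum_eq_zero fun b _ => if_neg fun hb => ?_
    have := D.orthogonal _ _ _ _ hb
    rcases u with u | u <;> rcases v with v | v <;> simp_all [pairOf]

theorem relayEnc_perm (p : Fin N × Fin G.q) (hp : p.1 < (D.perm p).1)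
    (h : Fin (D.perm p).1 → G.Signal) :
    C.relayEnc (D.perm p).1 h (D.perm p).2 = h ⟨p.1, hp⟩ p.2 := by
  rw [D.relay_eq]
  simp only [Prod.mk.eta, Equiv.symm_apply_apply, dif_pos hp]

/-- The forwarded level holds the wanted bit plus possibly a bit of `u` itself; adding the latter
once more cancels it in characteristic 2. -/
theorem correct (w : C.Messages) : C.Correct w := by
  intro u
  apply (D.bits u.swap).injective
  funext c
  have hlev := D.forward_level u c
  have hq := G.down_le_q u
  rw [D.dec_eq u _ _ c ⟨(D.perm (D.rx u.swap c)).2 + (G.q - G.down u), by omega⟩ rfl,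
    history_apply, received_terminal, dif_pos (by simp)]
  have hl : (⟨((D.perm (D.rx u.swap c)).2 : ℕ) + (G.q - G.down u) - (G.q - G.down u),
      by omega⟩ : Fin G.q) = (D.perm (D.rx u.swap c)).2 := Fin.ext (by simp)
  simp only [hl]
  rw [transmitted, if_neg (D.forward_transmit u c), D.relayEnc_perm _ (D.forward_later u c),
    history_apply, D.relay_received w _ (D.rx_listen _ c), Prod.mk.eta, D.sum_bits_rx w u c,
    add_assoc, CharTwo.add_self_eq_zero, add_zero]

theorem errorProb_eq_zero : C.errorProb = 0 := by
  have h : (Finset.univ.filter fun w : C.Messages =>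
      ∃ u, C.dec u (w u) (C.history w N (some u)) ≠ w u.swap) = ∅ :=
    Finset.filter_eq_empty_iff.2 fun w _ ⟨u, hu⟩ => hu (D.correct w u)
  rw [errorProb, h]
  simp

end DivideAndConquer
/-! ### The cut-set bound for codes -/

theorem card_messages (C : HalfDuplexCode G N) : Fintype.card C.Messages = ∏ u, C.size u := by
  simp [Messages, Fintype.card_pi]

open Classical in
theorem card_messages_le_two_mul_card_correct (C : HalfDuplexCode G N) (hC : C.errorProb ≤ 1 / 2) :
    Fintype.card C.Messages ≤ 2 * (Finset.univ.filter fun w => C.Correct w).card := by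
  have hpos : 0 < Fintype.card C.Messages := by
    rw [card_messages]
    exact Finset.prod_pos fun u _ => C.size_pos u
  rw [errorProb, div_le_iff₀ (by exact_mod_cast hpos)] at hC
  have hsplit := Finset.card_filter_add_card_filter_not (s := (Finset.univ : Finset C.Messages))
    fun w => ∃ u, C.dec u (w u) (C.history w N (some u)) ≠ w u.swap
  have hcor : (Finset.univ.filter fun w : C.Messages =>
      ¬ ∃ u, C.dec u (w u) (C.history w N (some u)) ≠ w u.swap) =
      Finset.univ.filter fun w => C.Correct w :=
    Finset.filter_congr fun w _ => by simp [Correct]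
  rw [hcor, Finset.card_univ] at hsplit
  have hsplit' := congrArg (Nat.cast : ℕ → ℝ) hsplit
  push_cast at hsplit'
  have : (Fintype.card C.Messages : ℝ) ≤
      2 * ((Finset.univ.filter fun w => C.Correct w).card : ℝ) := by
    linarith
  exact_mod_cast this

/-- If the correctly decoded messages of the terminals in `S` are determined by the other messages
and a quantity with values in `K`, then there are at most `2 * |K|` messages in `S`. -/
theorem prod_size_le (C : HalfDuplexCode G N) (hC : C.errorProb ≤ 1 / 2) (S : Finset (Terminal M))
    {K : Type} [Fintype K] (F : C.Messages → K)
    (hF : ∀ w w', C.Correct w → C.Correct w' → (∀ v ∉ S, w v = w' v) → F w = F w' →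
      ∀ v ∈ S, w v = w' v) :
    ∏ u ∈ S, C.size u ≤ 2 * Fintype.card K := by
  classical
  -- The value of `F` and the messages outside `S` together encode a correctly decoded tuple; the
  -- sizes outside `S` cancel at the end.
  have hinj : (Finset.univ.filter fun w => C.Correct w).card ≤
      (Finset.univ : Finset (K × ((v : {v // v ∈ Sᶜ}) → Fin (C.size v)))).card := by
    refine Finset.card_le_card_of_injOn (fun w => (F w, fun v => w v))
      (fun _ _ => Finset.mem_coe.2 (Finset.mem_univ _)) ?_
    intro w hw w' hw' h
    rw [Prod.ext_iff] at h
    have hout : ∀ v ∉ S, w v = w' v := fun v hv => congrFun h.2 ⟨v, Finset.mem_compl.2 hv⟩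
    funext v
    by_cases hv : v ∈ S
    · exact hF w w' (Finset.mem_filter.1 hw).2 (Finset.mem_filter.1 hw').2 hout h.1 v hv
    · exact hout v hv
  have hcard : (Finset.univ : Finset (K × ((v : {v // v ∈ Sᶜ}) → Fin (C.size v)))).card =
      Fintype.card K * ∏ v ∈ Sᶜ, C.size v := by
    rw [Finset.card_univ, Fintype.card_prod, Fintype.card_pi]
    congr 1
    simp only [Fintype.card_fin]
    exact Finset.prod_coe_sort Sᶜ fun v => C.size v
  have h2 := C.card_messages_le_two_mul_card_correct hC
  rw [card_messages, ← Finset.prod_mul_prod_compl S] at h2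
  rw [hcard] at hinj
  have hpos : 0 < ∏ v ∈ Sᶜ, C.size v := Finset.prod_pos fun u _ => C.size_pos u
  refine Nat.le_of_mul_le_mul_right (h2.trans ?_) hpos
  rw [mul_assoc]
  exact Nat.mul_le_mul_left 2 hinj

theorem eq_swap_of_history_eq (C : HalfDuplexCode G N) {w w' : C.Messages} (hw : C.Correct w)
    (hw' : C.Correct w') {u : Terminal M} (hu : w u = w' u)
    (h : C.history w N (some u) = C.history w' N (some u)) : w u.swap = w' u.swap := by
  rw [← hw u, ← hw' u, hu, h]

theorem received_terminal_congr (C : HalfDuplexCode G N) {w w' : C.Messages} {t : ℕ}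
    {h h' : Node M → Fin t → G.Signal} {u : Terminal M} {g : ℕ} (hgq : g ≤ G.q)
    (hg : G.down u ≤ g)
    (hx : ∀ k : Fin g, C.transmitted w t h none (k.castLE hgq) =
      C.transmitted w' t h' none (k.castLE hgq)) :
    C.received w t h (some u) = C.received w' t h' (some u) := by
  have := G.down_le_q u
  funext l
  rw [received_terminal, received_terminal]
  split_ifs with hl
  · exact hx ⟨l - (G.q - G.down u), by omega⟩
  · rfl

/-- Terminals in `S` reach only the `g` least significant levels; on the other levels the relay
hears only terminals whose messages agree. -/
theorem received_relay_congr (C : HalfDuplexCode G N) {w w' : C.Messages} {t : ℕ}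
    {h : Node M → Fin t → G.Signal} {S : Finset (Terminal M)} {g : ℕ}
    (hg : ∀ v ∈ S, G.up v ≤ g) (hout : ∀ v ∉ S, w v = w' v)
    (hy : t ∈ C.listen → ∀ l : Fin G.q, G.q - g ≤ (l : ℕ) →
      C.received w t h none l = C.received w' t h none l) :
    C.received w t h none = C.received w' t h none := by
  by_cases ht : t ∈ C.listen
  · funext l
    by_cases hl : G.q - g ≤ (l : ℕ)
    · exact hy ht l hl
    · rw [C.received_relay_of_mem w t h ht, C.received_relay_of_mem w' t h ht]
      refine Finset.sum_congr rfl fun u _ => ?_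
      by_cases hu : u ∈ S
      · have := hg u hu
        rw [dif_neg (by omega), dif_neg (by omega)]
      · rw [hout u hu]
  · rw [C.received_relay_of_notMem w t h ht, C.received_relay_of_notMem w' t h ht]

theorem history_congr (C : HalfDuplexCode G N) {w w' : C.Messages} {t : ℕ}
    (h : ∀ s < t, C.received w s (C.history w s) = C.received w' s (C.history w' s)) :
    C.history w t = C.history w' t := by
  funext v s
  rw [history_apply, history_apply, h s s.2]

/-- By `hS` the partner of a sender in `S` lies outside `S`, so its own message is fixed and its
estimate depends only on its history. -/
theorem prod_size_le_uplink (C : HalfDuplexCode G N) (hC : C.errorProb ≤ 1 / 2)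
    (S : Finset (Terminal M)) (hS : ∀ u, u.swap ∈ S → u ∉ S) {g : ℕ} (hgq : g ≤ G.q)
    (hg : ∀ v ∈ S, G.up v ≤ g) :
    ∏ u ∈ S, C.size u ≤ 2 * 2 ^ (g * C.listen.card) := by
  let F : C.Messages → (C.listen → Fin g → ZMod 2) := fun w t k =>
    C.received w t (C.history w t) none ⟨G.q - g + k, by omega⟩
  refine (C.prod_size_le hC S F ?_).trans_eq (by simp [pow_mul, ZMod.card])
  intro w w' hw hw' hout hFw v hv
  have key : ∀ t, C.received w t (C.history w t) = C.received w' t (C.history w' t) := by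
    intro t
    induction t using Nat.strong_induction_on with
    | _ t ih =>
      have hh := C.history_congr ih
      rw [hh]
      funext v
      rcases v with _ | u
      · refine C.received_relay_congr hg hout fun ht l hl => ?_
        have := congrFun (congrFun hFw ⟨t, ht⟩) ⟨l - (G.q - g), by omega⟩
        have hl' : (⟨G.q - g + (l - (G.q - g)), by omega⟩ : Fin G.q) = l :=
          Fin.ext (by simp only; omega)
        simp only [F, hl', hh] at this
        exact this
      -- The relay has no message: with equal histories it transmits equal signals.
      · exact C.received_terminal_congr le_rfl (G.down_le_q u) fun k => rfl
  obtain ⟨u, rfl⟩ : ∃ u : Terminal M, v = u.swap := ⟨v.swap, (Sum.swap_swap v).symm⟩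
  exact C.eq_swap_of_history_eq hw hw' (hout u (hS u hv))
    (congrFun (C.history_congr fun s _ => key s) _)

/-- No induction over time is needed, since the recorded relay signals fix what the receivers get
directly; in listening slots the relay sends zero. -/
theorem prod_size_le_downlink (C : HalfDuplexCode G N) (hC : C.errorProb ≤ 1 / 2)
    (S : Finset (Terminal M)) (hS : ∀ u, u.swap ∈ S → u ∉ S) {g : ℕ} (hgq : g ≤ G.q)
    (hg : ∀ u, u.swap ∈ S → G.down u ≤ g) :
    ∏ u ∈ S, C.size u ≤ 2 * 2 ^ (g * (N - C.listen.card)) := by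
  let F : C.Messages → (↑(Finset.range N \ C.listen) → Fin g → ZMod 2) := fun w t k =>
    C.transmitted w t (C.history w t) none (k.castLE hgq)
  refine (C.prod_size_le hC S F ?_).trans_eq ?_
  · intro w w' hw hw' hout hFw v hv
    obtain ⟨u, rfl⟩ : ∃ u : Terminal M, v = u.swap := ⟨v.swap, (Sum.swap_swap v).symm⟩
    refine C.eq_swap_of_history_eq hw hw' (hout u (hS u hv)) (funext fun t => ?_)
    rw [history_apply, history_apply]
    refine C.received_terminal_congr hgq (hg u hv) fun k => ?_
    by_cases ht : (t : ℕ) ∈ C.listen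
    · simp only [transmitted, if_pos ht]
    · exact congrFun (congrFun hFw ⟨t, by simp [ht]⟩) k
  · simp [pow_mul, ZMod.card, Finset.card_sdiff_of_subset C.listen_subset]

end HalfDuplexCode

/-! ### The cut-set bound for rates -/

/-- The excess `1 + g` stays bounded, so it disappears after division by `N`. -/
theorem le_mul_of_eventually {σ D : ℝ} {g : ℕ}
    (h : ∀ᶠ N : ℕ in atTop, (N : ℝ) * σ ≤ 1 + g * (D * N + 1)) : σ ≤ D * g := by
  by_contra! hlt
  have hlim : Tendsto (fun N : ℕ => (N : ℝ) * (σ - D * g)) atTop atTop :=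
    tendsto_natCast_atTop_atTop.atTop_mul_const (sub_pos.2 hlt)
  obtain ⟨N, h1, h2⟩ := (h.and (hlim.eventually_gt_atTop (1 + (g : ℝ)))).exists
  nlinarith

/-- If a code with at least `2 ^ (N R u)` messages at `u` has at most `2 * 2 ^ (g n)` messages
in `S`, where `n < D N + 1`, then the rates in `S` add up to at most `1 / N + g (D + 1 / N)`. -/
theorem sum_rate_le {C : Terminal M → ℕ} {R : Terminal M → ℝ} {N n g : ℕ} {D : ℝ}
    {S : Finset (Terminal M)} (hR : ∀ u, (2 : ℝ) ^ ((N : ℝ) * R u) ≤ C u)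
    (hn : (n : ℝ) ≤ D * N + 1) (hC : ∏ u ∈ S, C u ≤ 2 * 2 ^ (g * n)) :
    (N : ℝ) * ∑ u ∈ S, R u ≤ 1 + g * (D * N + 1) := by
  have h1 : (2 : ℝ) ^ ((N : ℝ) * ∑ u ∈ S, R u) ≤ (2 : ℝ) ^ (1 + (g : ℝ) * n) := by
    rw [Finset.mul_sum, Real.rpow_sum_of_pos two_pos, Real.rpow_add two_pos, Real.rpow_one,
      ← Nat.cast_mul, Real.rpow_natCast]
    refine (Finset.prod_le_prod (fun u _ => by positivity) fun u _ => hR u).trans ?_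
    exact_mod_cast hC
  have h2 := (Real.rpow_le_rpow_left_iff one_lt_two).1 h1
  have h3 : (g : ℝ) * n ≤ g * (D * N + 1) := mul_le_mul_of_nonneg_left hn (Nat.cast_nonneg g)
  linarith

/-- The terminals that send across the cut given by `U` and `ℓ`. -/
def source (ℓ : Fin M → Bool) (i : Fin M) : Terminal M := if ℓ i then nodeA i else nodeB i

theorem pairOf_source (ℓ : Fin M → Bool) (i : Fin M) : pairOf (source ℓ i) = i := by
  unfold source
  split_ifs <;> rfl

theorem source_injective (ℓ : Fin M → Bool) : Function.Injective (source ℓ) :=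
  Function.LeftInverse.injective (pairOf_source ℓ)

theorem swap_source_ne (ℓ : Fin M → Bool) (i j : Fin M) : (source ℓ i).swap ≠ source ℓ j := by
  intro h
  have hij := congrArg pairOf h
  rw [pairOf_source] at hij
  unfold source at h hij
  split_ifs at h hij <;> simp_all [pairOf]

theorem Achievable.mem_cutSetRegion {Δ : ℝ} {R : Terminal M → ℝ}
    (h : Achievable G Δ (fun _ _ => True) R) : R ∈ cutSetRegion G Δ := by
  classical
  refine ⟨h.1, fun U ℓ => ?_⟩
  have hS : ∀ u, u.swap ∈ U.image (source ℓ) → u ∉ U.image (source ℓ) := by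
    intro u hu hu'
    obtain ⟨i, -, hi⟩ := Finset.mem_image.1 hu
    obtain ⟨j, -, rfl⟩ := Finset.mem_image.1 hu'
    exact swap_source_ne ℓ j i hi.symm
  have hsum : (∑ i ∈ U, if ℓ i then R (nodeA i) else R (nodeB i)) =
      ∑ u ∈ U.image (source ℓ), R u := by
    rw [Finset.sum_image (source_injective ℓ).injOn]
    refine Finset.sum_congr rfl fun i _ => ?_
    unfold source
    split_ifs <;> rfl
  rw [hsum]
  refine le_min (le_mul_of_eventually ?_) (le_mul_of_eventually ?_) <;>
    filter_upwards [h.2 (1 / 2) (by norm_num)] with N hN <;>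
    obtain ⟨C, -, hL, hC, hR⟩ := hN <;>
    have hL' := abs_lt.1 hL
  · refine sum_rate_le hR (by linarith [hL'.2]) (C.prod_size_le_uplink hC _ hS ?_ ?_)
    · refine Finset.sup_le fun i _ => ?_
      split_ifs <;> exact G.up_le_q _
    · intro v hv
      obtain ⟨i, hi, rfl⟩ := Finset.mem_image.1 hv
      refine le_trans (le_of_eq ?_) (Finset.le_sup hi)
      unfold source
      split_ifs <;> rfl
  · have hcard : C.listen.card ≤ N := by
      simpa using Finset.card_le_card C.listen_subset
    refine sum_rate_le (n := N - C.listen.card) hR ?_ (C.prod_size_le_downlink hC _ hS ?_ ?_)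
    · rw [Nat.cast_sub hcard]
      linarith [hL'.1]
    · refine Finset.sup_le fun i _ => ?_
      split_ifs <;> exact G.down_le_q _
    · intro u hu
      obtain ⟨i, hi, h'⟩ := Finset.mem_image.1 hu
      obtain rfl : u = (source ℓ i).swap := by rw [h', Sum.swap_swap]
      refine le_trans (le_of_eq ?_) (Finset.le_sup hi)
      unfold source
      split_ifs <;> rfl

theorem isClosed_cutSetRegion (G : Gains M) (Δ : ℝ) : IsClosed (cutSetRegion G Δ) := by
  simp only [cutSetRegion, Set.ofPred_and, Set.ofPred_forall]
  refine IsClosed.inter (isClosed_iInter fun u => isClosed_le continuous_const (continuous_apply u))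
    (isClosed_iInter fun U => isClosed_iInter fun ℓ => isClosed_le ?_ continuous_const)
  refine continuous_finsetSum _ fun i _ => ?_
  split_ifs <;> exact continuous_apply _

theorem capacityRegion_subset_cutSetRegion (G : Gains M) (Δ : ℝ) :
    capacityRegion G Δ ⊆ cutSetRegion G Δ :=
  closure_minimal (fun _ h => h.mem_cutSetRegion) (isClosed_cutSetRegion G Δ)

theorem divideAndConquerRegion_subset_capacityRegion (G : Gains M) (Δ : ℝ) :
    divideAndConquerRegion G Δ ⊆ capacityRegion G Δ :=
  closure_mono fun _ h => ⟨h.1, fun ε hε => (h.2 ε hε).mono fun _ ⟨C, _, h'⟩ => ⟨C, trivial, h'⟩⟩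

/-! ### Allocation of signal levels -/

/-- The packets that the relay forwards for the pairs if `u` sends `k u` bits: a bit of `A_i` and
the bit of `B_i` with the same index, if there are both, are superposed. -/
abbrev Packet (k : Terminal M → ℕ) : Type :=
  Σ i : Fin M, Fin (max (k (nodeA i)) (k (nodeB i)))

/-- The least of the gains `x u` of the terminals `u` that have a bit in the packet. -/
def packetGain (x k : Terminal M → ℕ) (p : Packet k) : ℕ :=
  if (p.2 : ℕ) < k (nodeA p.1) then
    if (p.2 : ℕ) < k (nodeB p.1) then min (x (nodeA p.1)) (x (nodeB p.1)) else x (nodeA p.1)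
  else x (nodeB p.1)

theorem le_max_pairOf (k : Terminal M → ℕ) (u : Terminal M) :
    k u ≤ max (k (nodeA (pairOf u))) (k (nodeB (pairOf u))) := by
  rcases u with i | i
  · exact le_max_left _ _
  · exact le_max_right _ _

/-- The packet that contains the bit `b` of `u`. -/
def packetOf {k : Terminal M → ℕ} (u : Terminal M) (b : Fin (k u)) : Packet k :=
  ⟨pairOf u, b.castLE (le_max_pairOf k u)⟩

theorem packetOf_injective {k : Terminal M → ℕ} (u : Terminal M) :
    Function.Injective (packetOf (k := k) u) := by
  intro b c h
  simpa [packetOf] using h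

theorem packetGain_packetOf_le (x : Terminal M → ℕ) {k : Terminal M → ℕ} (u : Terminal M)
    (b : Fin (k u)) : packetGain x k (packetOf u b) ≤ x u := by
  have hb := b.2
  rcases u with i | i
  · change (if (b : ℕ) < k (nodeA i) then
      if (b : ℕ) < k (nodeB i) then min (x (nodeA i)) (x (nodeB i)) else x (nodeA i)
      else x (nodeB i)) ≤ x (nodeA i)
    rw [if_pos hb]
    split_ifs
    · exact min_le_left _ _
    · exact le_rfl
  · change (if (b : ℕ) < k (nodeA i) then
      if (b : ℕ) < k (nodeB i) then min (x (nodeA i)) (x (nodeB i)) else x (nodeA i)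
      else x (nodeB i)) ≤ x (nodeB i)
    rw [if_pos (c := (b : ℕ) < k (nodeB i)) hb]
    split_ifs
    · exact min_le_right _ _
    · exact le_rfl

/-- Call a terminal weak if its gain is at most `g`. A packet counts exactly if it contains a bit of
a weak terminal, so each pair contributes the number of bits of its weak terminal, or the larger of
the two numbers if both are weak. -/
theorem card_packetGain_le {x k : Terminal M → ℕ} {n : ℕ}
    (hcut : ∀ (U : Finset (Fin M)) (ℓ : Fin M → Bool),
      ∑ i ∈ U, k (source ℓ i) ≤ n * U.sup fun i => x (source ℓ i)) (g : ℕ) :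
    (Finset.univ.filter fun p => packetGain x k p ≤ g).card ≤ n * g := by
  classical
  -- Select the weak terminal of the pair, and the one with more bits if both are weak.
  let ℓ : Fin M → Bool := fun i =>
    decide (x (nodeA i) ≤ g ∧ (k (nodeB i) ≤ k (nodeA i) ∨ ¬ x (nodeB i) ≤ g))
  let U : Finset (Fin M) := Finset.univ.filter fun i => x (nodeA i) ≤ g ∨ x (nodeB i) ≤ g
  have hsub : (Finset.univ.filter fun p => packetGain x k p ≤ g) ⊆
      U.sigma fun i => Finset.univ.filter fun j => (j : ℕ) < k (source ℓ i) := by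
    rintro ⟨i, j⟩ hp
    have hj := j.2
    replace hp := (Finset.mem_filter.1 hp).2
    simp only [packetGain] at hp
    simp only [Finset.mem_sigma, Finset.mem_filter, Finset.mem_univ, true_and, U, source, ℓ,
      decide_eq_true_eq]
    grind
  have hsup : (U.sup fun i => x (source ℓ i)) ≤ g := by
    refine Finset.sup_le fun i hi => ?_
    simp only [Finset.mem_filter, Finset.mem_univ, true_and, U] at hi
    simp only [source, ℓ, decide_eq_true_eq]
    grind
  refine (Finset.card_le_card hsub).trans ?_
  rw [Finset.card_sigma]
  refine (Finset.sum_le_sum fun i _ => ?_).trans ((hcut U ℓ).trans (Nat.mul_le_mul_left n hsup))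
  rw [← Finset.card_range (k (source ℓ i))]
  exact Finset.card_le_card_of_injOn Fin.val (fun j hj => by simpa using hj)
    Fin.val_injective.injOn

/-- Hall's marriage theorem: the admissible sets are nested, so the union over `s` contains the set
of its packet of largest gain, and `s` lies among the packets of at most that gain. -/
theorem exists_positions {x k : Terminal M → ℕ} {N q : ℕ} (hx : ∀ u, x u ≤ q) (T : Finset (Fin N))
    (hcut : ∀ (U : Finset (Fin M)) (ℓ : Fin M → Bool),
      ∑ i ∈ U, k (source ℓ i) ≤ T.card * U.sup fun i => x (source ℓ i)) :
    ∃ f : Packet k → Fin N × Fin q, Function.Injective f ∧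
      ∀ p, (f p).1 ∈ T ∧ ((f p).2 : ℕ) < packetGain x k p := by
  classical
  have hle : ∀ p, packetGain x k p ≤ q := by
    intro p
    unfold packetGain
    split_ifs
    · exact (min_le_left _ _).trans (hx _)
    · exact hx _
    · exact hx _
  obtain ⟨f, hf, hf'⟩ := (Finset.all_card_le_biUnion_card_iff_exists_injective
    fun p : Packet k => T ×ˢ (Finset.univ.filter fun l : Fin q => (l : ℕ) < packetGain x k p)).1 <| by
    intro s
    rcases s.eq_empty_or_nonempty with rfl | hs
    · simp
    obtain ⟨p, hp, hmax⟩ := s.exists_max_image (packetGain x k) hs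
    refine (Finset.card_le_card fun r hr => Finset.mem_filter.2
      ⟨Finset.mem_univ r, hmax r hr⟩).trans ((card_packetGain_le hcut (packetGain x k p)).trans ?_)
    refine le_trans (le_of_eq ?_) (Finset.card_le_card (Finset.subset_biUnion_of_mem _ hp))
    rw [Finset.card_product, Fin.card_filter_val_lt, min_eq_right (hle p)]
  exact ⟨f, hf, fun p => by simpa using hf' p⟩

theorem exists_perm_extending {ι α : Type*} [Finite α] {f g : ι → α} (hf : Function.Injective f)
    (hg : Function.Injective g) : ∃ e : Equiv.Perm α, ∀ i, e (f i) = g i := by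
  classical
  have := Fintype.ofFinite α
  let e := (Equiv.ofInjective f hf).symm.trans (Equiv.ofInjective g hg)
  refine ⟨Equiv.extendSubtype (p := (· ∈ Set.range f)) (q := (· ∈ Set.range g)) e, fun i => ?_⟩
  rw [Equiv.extendSubtype_apply_of_mem _ _ ⟨i, rfl⟩]
  have : (Equiv.ofInjective f hf).symm ⟨f i, ⟨i, rfl⟩⟩ = i := by
    rw [Equiv.symm_apply_eq]; rfl
  simp only [e, Equiv.trans_apply, this]
  rfl

/-! ### Divide-and-conquer strategies from an allocation -/

/-- The code in which the bit `b` of `u` is sent so that the relay receives it at `rx u b`, and in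
which the relay listens in the first `L` slots and reorders the levels by `perm`. -/
noncomputable def relayingCode (G : Gains M) {N : ℕ} (L : ℕ) (hL : L ≤ N) {k : Terminal M → ℕ}
    (bits : (u : Terminal M) → Fin (2 ^ k u) ≃ (Fin (k u) → ZMod 2))
    (rx : (u : Terminal M) → Fin (k u) → Fin N × Fin G.q)
    (perm : Equiv.Perm (Fin N × Fin G.q)) : HalfDuplexCode G N where
  listen := Finset.range L
  listen_subset := Finset.range_subset_range.2 hL
  size u := 2 ^ k u
  size_pos u := by positivity
  enc u w t _ l := ∑ b, if ((rx u b).1 : ℕ) = t ∧ ((rx u b).2 : ℕ) = (l : ℕ) + (G.q - G.up u)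
    then bits u w b else 0
  relayEnc t h l := if ht : t < N then
    if hs : ((perm.symm (⟨t, ht⟩, l)).1 : ℕ) < t then
      h ⟨(perm.symm (⟨t, ht⟩, l)).1, hs⟩ (perm.symm (⟨t, ht⟩, l)).2 else 0
    else 0
  dec u w y := (bits u.swap).symm fun c =>
    if hl : ((perm (rx u.swap c)).2 : ℕ) + (G.q - G.down u) < G.q then
      y (perm (rx u.swap c)).1 ⟨_, hl⟩ + ∑ b, if rx u b = rx u.swap c then bits u w b else 0
    else 0

/-- Since all listening slots precede all transmitting slots, any matching of uplink with downlink
positions is causal. -/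
theorem exists_divideAndConquer (G : Gains M) {N L : ℕ} (hL : L ≤ N) (k : Terminal M → ℕ)
    (hup : ∀ (U : Finset (Fin M)) (ℓ : Fin M → Bool),
      ∑ i ∈ U, k (source ℓ i) ≤ L * U.sup fun i => G.up (source ℓ i))
    (hdown : ∀ (U : Finset (Fin M)) (ℓ : Fin M → Bool),
      ∑ i ∈ U, k (source ℓ i) ≤ (N - L) * U.sup fun i => G.down (source ℓ i).swap) :
    ∃ C : HalfDuplexCode G N, C.IsDivideAndConquer ∧ C.listen = Finset.range L ∧
      ∀ u, C.size u = 2 ^ k u := by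
  classical
  have hcard : (Finset.univ.filter fun t : Fin N => (t : ℕ) < L).card = L := by
    rw [Fin.card_filter_val_lt, min_eq_right hL]
  have hcard' : (Finset.univ.filter fun t : Fin N => ¬ (t : ℕ) < L).card = N - L := by
    have := Finset.card_filter_add_card_filter_not (s := (Finset.univ : Finset (Fin N)))
      fun t => (t : ℕ) < L
    rw [hcard, Finset.card_univ, Fintype.card_fin] at this
    omega
  obtain ⟨f, hf, hf'⟩ := exists_positions (k := k) G.up_le_q
    (Finset.univ.filter fun t : Fin N => (t : ℕ) < L) (by rwa [hcard])
  -- The bits of `u` must reach its partner, so the relevant gain is that of `u.swap`.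
  obtain ⟨g, hg, hg'⟩ := exists_positions (k := k) (x := fun u => G.down u.swap)
    (fun u => G.down_le_q _)
    (Finset.univ.filter fun t : Fin N => ¬ (t : ℕ) < L) (by rwa [hcard'])
  simp only [Finset.mem_filter, Finset.mem_univ, true_and] at hf' hg'
  -- A weak uplink reaches the bottom levels of the relay, whereas a weak downlink sees the top
  -- ones; hence the reversal for the uplink only.
  let f₁ : Packet k → Fin N × Fin G.q := fun p => ((f p).1, (f p).2.rev)
  have hf₁ : Function.Injective f₁ := fun p p' h =>
    hf (Prod.ext (Prod.ext_iff.1 h).1 (Fin.rev_injective (Prod.ext_iff.1 h).2))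
  obtain ⟨perm, hperm⟩ := exists_perm_extending hf₁ hg
  let bits : (u : Terminal M) → Fin (2 ^ k u) ≃ (Fin (k u) → ZMod 2) := fun u =>
    (Fintype.equivFinOfCardEq (by simp [ZMod.card])).symm
  refine ⟨relayingCode G L hL bits (fun u b => f₁ (packetOf u b)) perm, ⟨?_⟩, rfl, fun _ => rfl⟩
  refine
    { k := k
      bits := bits
      rx := fun u => ⟨fun b => f₁ (packetOf u b), hf₁.comp (packetOf_injective u)⟩
      rx_listen := fun u b => Finset.mem_range.2 (hf' _).1
      rx_level := fun u b => ?_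
      orthogonal := fun u v b c h => congrArg Sigma.fst (hf₁ h)
      enc_eq := fun u w t h l => ?_
      perm := perm
      relay_eq := fun t h l => ?_
      forward_later := fun u c => ?_
      forward_transmit := fun u c => ?_
      forward_level := fun u c => ?_
      dec_eq := fun u w y c l hl => ?_ }
  · have h1 := (hf' (packetOf u b)).2
    have h2 := packetGain_packetOf_le G.up u b
    simp only [Function.Embedding.coeFn_mk, f₁, Fin.val_rev]
    omega
  · simp only [relayingCode, Function.Embedding.coeFn_mk, Fin.ext_iff]
    rfl
  · simp only [relayingCode, dif_pos t.2]
    rfl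
  · simp only [Function.Embedding.coeFn_mk, hperm]
    exact Fin.lt_def.2 (lt_of_lt_of_le (hf' _).1 (not_lt.1 (hg' _).1))
  · simp only [Function.Embedding.coeFn_mk, hperm]
    exact fun h => (hg' _).1 (Finset.mem_range.1 h)
  · simp only [Function.Embedding.coeFn_mk, hperm]
    have h2 := packetGain_packetOf_le (fun u => G.down u.swap) u.swap c
    rw [Sum.swap_swap] at h2
    exact lt_of_lt_of_le (hg' _).2 h2
  · have hlt := l.2
    rw [hl] at hlt
    obtain rfl : l = ⟨_, hlt⟩ := Fin.ext hl
    exact (congrFun (Equiv.apply_symm_apply (bits u.swap) _) c).trans (dif_pos hlt)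

/-! ### Achievability -/

/-- Rounding up the rates costs at most `M ≤ M * g` bits and rounding the slots at most `g`; the
slack `δ * D * N * g` covers both. If `D` or `g` is zero, all rates in the sum vanish. -/
theorem sum_ceil_le {ι : Type*} {s : Finset ι} {ρ : ι → ℝ} {D δ : ℝ} {M N n g : ℕ}
    (hs : s.card ≤ M) (hρ : ∀ i, 0 ≤ ρ i) (hδ1 : δ ≤ 1) (hD : D = 0 ∨ (M : ℝ) + 1 ≤ δ * D * N)
    (hn : D * N - 1 ≤ n) (h : ∑ i ∈ s, ρ i ≤ D * g) :
    ∑ i ∈ s, ⌈(N : ℝ) * ((1 - δ) * ρ i)⌉₊ ≤ n * g := by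
  by_cases h0 : D = 0 ∨ g = 0
  · have hz : D * g = 0 := by rcases h0 with h0 | h0 <;> simp [h0]
    rw [hz] at h
    have h1 := (Finset.sum_eq_zero_iff_of_nonneg fun i _ => hρ i).1
      (h.antisymm (Finset.sum_nonneg fun i _ => hρ i))
    rw [Finset.sum_eq_zero fun i hi => by simp [h1 i hi]]
    exact Nat.zero_le _
  · rw [not_or] at h0
    have hg : (1 : ℝ) ≤ g := by exact_mod_cast Nat.one_le_iff_ne_zero.2 h0.2
    have hM := hD.resolve_left h0.1
    have h1 : (∑ i ∈ s, (⌈(N : ℝ) * ((1 - δ) * ρ i)⌉₊ : ℝ)) ≤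
        N * ((1 - δ) * ∑ i ∈ s, ρ i) + M := by
      calc (∑ i ∈ s, (⌈(N : ℝ) * ((1 - δ) * ρ i)⌉₊ : ℝ))
          ≤ ∑ i ∈ s, ((N : ℝ) * ((1 - δ) * ρ i) + 1) := Finset.sum_le_sum fun i _ =>
            (Nat.ceil_lt_add_one (mul_nonneg (Nat.cast_nonneg N)
              (mul_nonneg (by linarith) (hρ i)))).le
        _ = N * ((1 - δ) * ∑ i ∈ s, ρ i) + s.card := by
            rw [Finset.sum_add_distrib, Finset.mul_sum, Finset.mul_sum]
            simp
        _ ≤ _ := by gcongr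
    have h2 : (N : ℝ) * ((1 - δ) * ∑ i ∈ s, ρ i) ≤ N * ((1 - δ) * (D * g)) :=
      mul_le_mul_of_nonneg_left (mul_le_mul_of_nonneg_left h (by linarith)) (Nat.cast_nonneg N)
    have h3 : (D * N - 1) * g ≤ n * g := mul_le_mul_of_nonneg_right hn (by linarith)
    have h4 : ((M : ℝ) + 1) * g ≤ δ * D * N * g := mul_le_mul_of_nonneg_right hM (by linarith)
    have h5 : (M : ℝ) * 1 ≤ M * g := mul_le_mul_of_nonneg_left hg (Nat.cast_nonneg M)
    have h6 : (∑ i ∈ s, (⌈(N : ℝ) * ((1 - δ) * ρ i)⌉₊ : ℝ)) ≤ n * g := by linarith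
    exact_mod_cast h6

theorem eventually_eq_zero_or_le {D δ : ℝ} (hD : 0 ≤ D) (hδ : 0 < δ) (c : ℝ) :
    ∀ᶠ N : ℕ in atTop, D = 0 ∨ c ≤ δ * D * N := by
  rcases hD.eq_or_lt with h | h
  · exact Eventually.of_forall fun _ => Or.inl h.symm
  · filter_upwards [(tendsto_natCast_atTop_atTop.const_mul_atTop
      (mul_pos hδ h)).eventually_ge_atTop c] with N hN
    exact Or.inr hN

theorem achievable_of_mem_cutSetRegion {Δ δ : ℝ} (hΔ0 : 0 ≤ Δ) (hΔ1 : Δ ≤ 1) (hδ0 : 0 < δ)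
    (hδ1 : δ ≤ 1) {R : Terminal M → ℝ} (hR : R ∈ cutSetRegion G Δ) :
    Achievable G Δ (fun _ C => C.IsDivideAndConquer) fun u => (1 - δ) * R u := by
  refine ⟨fun u => mul_nonneg (by linarith) (hR.1 u), fun ε hε => ?_⟩
  filter_upwards [eventually_eq_zero_or_le hΔ0 hδ0 (M + 1),
    eventually_eq_zero_or_le (sub_nonneg.2 hΔ1) hδ0 (M + 1)] with N hN hN'
  have hΔN : 0 ≤ Δ * N := mul_nonneg hΔ0 (Nat.cast_nonneg N)
  have hfl := Nat.floor_le hΔN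
  -- Rounding the listening time down loses less than one uplink slot and no downlink slots.
  have hlt := Nat.lt_floor_add_one (Δ * N)
  have hL : ⌊Δ * (N : ℝ)⌋₊ ≤ N :=
    Nat.floor_le_of_le (mul_le_of_le_one_left (Nat.cast_nonneg N) hΔ1)
  have hcut : ∀ (U : Finset (Fin M)) (ℓ : Fin M → Bool), ∑ i ∈ U, R (source ℓ i) ≤
      min (Δ * ((U.sup fun i => G.up (source ℓ i) : ℕ) : ℝ))
        ((1 - Δ) * ((U.sup fun i => G.down (source ℓ i).swap : ℕ) : ℝ)) := by
    intro U ℓ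
    convert hR.2 U ℓ using 7 <;> unfold source <;> split_ifs <;> rfl
  have hU : ∀ U : Finset (Fin M), U.card ≤ M := fun U => by simpa using U.card_le_univ
  obtain ⟨C, hC, hlisten, hsize⟩ := exists_divideAndConquer G hL
    (fun u => ⌈(N : ℝ) * ((1 - δ) * R u)⌉₊)
    (fun U ℓ => sum_ceil_le (ρ := fun i => R (source ℓ i)) (hU U) (fun i => hR.1 _) hδ1 hN
      (by linarith) ((hcut U ℓ).trans (min_le_left _ _)))
    (fun U ℓ => sum_ceil_le (ρ := fun i => R (source ℓ i)) (hU U) (fun i => hR.1 _) hδ1 hN'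
      (by rw [Nat.cast_sub hL]; linarith) ((hcut U ℓ).trans (min_le_right _ _)))
  refine ⟨C, hC, ?_, ?_, fun u => ?_⟩
  · rw [HalfDuplexCode.ListensFraction, hlisten, Finset.card_range, abs_lt]
    constructor <;> linarith
  · obtain ⟨D⟩ := hC
    rw [D.errorProb_eq_zero]
    exact hε.le
  · rw [hsize, Nat.cast_pow, Nat.cast_ofNat, ← Real.rpow_natCast]
    exact Real.rpow_le_rpow_of_exponent_le one_le_two (Nat.le_ceil _)

theorem cutSetRegion_subset_divideAndConquerRegion (G : Gains M) {Δ : ℝ} (hΔ0 : 0 ≤ Δ)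
    (hΔ1 : Δ ≤ 1) : cutSetRegion G Δ ⊆ divideAndConquerRegion G Δ := by
  intro R hR
  have hlim : Tendsto (fun δ : ℝ => fun u => (1 - δ) * R u) (nhdsWithin 0 (Set.Ioi 0))
      (nhds R) := by
    have hc : Continuous fun δ : ℝ => fun u => (1 - δ) * R u := by fun_prop
    simpa using (hc.tendsto 0).mono_left nhdsWithin_le_nhds
  refine mem_closure_of_tendsto hlim ?_
  filter_upwards [Ioo_mem_nhdsGT (zero_lt_one' ℝ)] with δ hδ
  exact achievable_of_mem_cutSetRegion hΔ0 hΔ1 hδ.1 hδ.2.le hR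

end BidirRelay

theorem mainTheorem2 (M : ℕ) (G : BidirRelay.Gains M) (Δ : ℝ) (hΔ0 : 0 ≤ Δ) (hΔ1 : Δ ≤ 1) :
    BidirRelay.capacityRegion G Δ = BidirRelay.cutSetRegion G Δ ∧
      BidirRelay.divideAndConquerRegion G Δ = BidirRelay.cutSetRegion G Δ := by
  have h1 := BidirRelay.capacityRegion_subset_cutSetRegion G Δ
  have h2 := BidirRelay.divideAndConquerRegion_subset_capacityRegion G Δ
  have h3 := BidirRelay.cutSetRegion_subset_divideAndConquerRegion G hΔ0 hΔ1
  exact ⟨h1.antisymm (h3.trans h2), (h2.trans h1).antisymm h3⟩
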